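/- Let $\mathbb{T}$ be the unit circle with normalised arc length $d\theta/2\pi$, let $L^2=L^2(\mathbb{T})$, and let $H^2\subset L^2$ be the Hardy space, i.e. the closed subspace of functions whose Fourier coefficients of negative index vanish. Let $R_+:L^2\to H^2$ and $R_-:L^2\to L^2\ominus H^2$ be the orthogonal projections, let $M_\phi$ be multiplication by $\phi$, and let $J:L^2\to L^2$ be the flip $Jh(z)=\bar z\,h(\bar z)$, which interchanges $H^2$ and $L^2\ominus H^2$. For $\phi\in L^\infty(\mathbb{T})$ the Hankel operator $\Gamma_\phi:H^2\to H^2$ is $\Gamma_\phi=JR_-M_\phi$. Let $f,g\in L^\infty(\mathbb{T})$ satisfy $\bar f=g$ almost everywhere, and put $$K(\theta,\varphi)=\frac{f(e^{i\theta})g(e^{i\varphi})-f(e^{i\varphi})g(e^{i\theta})}{1-e^{i(\theta-\varphi)}}.$$ Then the integral operator $W$ with kernel $K$ is a bounded operator on $L^2$: there is a bounded linear operator $W:L^2\to L^2$ such that, for every $h\in L^2$ and almost every $\theta$, $$Wh(e^{i\theta})=\lim_{\varepsilon\downarrow 0}\frac1{2\pi}\int_{|\theta-\varphi|>\varepsilon}K(\theta,\varphi)\,h(e^{i\varphi})\,d\varphi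 ,$$ where $|\theta-\varphi|$ is the distance modulo $2\pi$ (the integral being taken as a principal value on the diagonal). Moreover $W$ is self-adjoint, its compression $R_+WR_+:H^2\to H^2$ satisfies $$R_+WR_+=\Gamma_f^*\Gamma_f-\Gamma_g^*\Gamma_g ,$$ and if $f$ is continuous (that is, agrees almost everywhere with a continuous function on $\mathbb{T}$), then $R_+WR_+$ is compact. -/

import Mathlib

open MeasureTheory Filter Topology ComplexConjugate
open scoped ENNReal

noncomputable section

namespace HankelCircle

instance instFactTwoPiPos : Fact (0 < 2 * Real.pi) := ⟨Real.two_pi_pos⟩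

/-- The unit circle, parametrised by the angle `θ ∈ ℝ / 2πℤ`; the point with angle `θ` is
`fourier 1 θ = e^{iθ}`. -/
abbrev T : Type := AddCircle (2 * Real.pi)

/-- Normalised arc length `dθ / 2π`. -/
abbrev arc : Measure T := AddCircle.haarAddCircle

abbrev L2 : Type := Lp ℂ 2 arc

abbrev LInfty : Type := Lp ℂ ∞ arc

/-- The Hardy space `H²`: the elements of `L²` whose negative Fourier coefficients vanish. -/
def H2 : Submodule ℂ L2 where
  carrier := {h | ∀ n : ℤ, n < 0 → fourierCoeff h n = 0}
  zero_mem' := by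
    intro n _
    rw [← fourierBasis_repr]
    simp
  add_mem' := by
    intro a b ha hb n hn
    have h1 := ha n hn
    have h2 := hb n hn
    rw [← fourierBasis_repr] at h1 h2 ⊢
    simp [h1, h2]
  smul_mem' := by
    intro c a ha n hn
    have h1 := ha n hn
    rw [← fourierBasis_repr] at h1 ⊢
    simp [h1]

theorem mem_H2 {h : L2} : h ∈ H2 ↔ ∀ n : ℤ, n < 0 → fourierCoeff h n = 0 := Iff.rfl

theorem fourierCoeff_eq_inner (h : L2) (n : ℤ) :
    fourierCoeff h n = inner ℂ (fourierLp 2 n : L2) h := by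
  rw [← fourierBasis_repr, HilbertBasis.repr_apply_apply, coe_fourierBasis]

theorem isClosed_H2 : IsClosed (H2 : Set L2) := by
  have h : (H2 : Set L2) =
      ⋂ n : ℤ, ⋂ _ : n < 0, {h : L2 | inner ℂ (fourierLp 2 n : L2) h = 0} := by
    ext h
    simp only [SetLike.mem_coe, mem_H2, Set.mem_iInter, Set.mem_ofPred_eq, fourierCoeff_eq_inner]
  rw [h]
  exact isClosed_iInter fun n => isClosed_iInter fun _ =>
    isClosed_eq (by fun_prop) continuous_const

instance instCompleteSpaceH2 : CompleteSpace H2 := isClosed_H2.completeSpace_coe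

/-- The Riesz projection `R₊ : L² → H²`. -/
def Rplus : L2 →L[ℂ] H2 := H2.orthogonalProjectionOnto

/-- The Riesz projection `R₋ : L² → L² ⊖ H²`. -/
def Rminus : L2 →L[ℂ] H2ᗮ := H2ᗮ.orthogonalProjectionOnto

/-- Multiplication by an essentially bounded symbol, `(M_φ h)(θ) = φ(θ) h(θ)`. -/
def mulOp (φ : LInfty) : L2 →L[ℂ] L2 :=
  (ContinuousLinearMap.mul ℂ ℂ).holderL arc ∞ 2 2 φ

theorem coeFn_mulOp (φ : LInfty) (h : L2) : mulOp φ h =ᵐ[arc] fun θ => φ θ * h θ :=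
  (ContinuousLinearMap.mul ℂ ℂ).coeFn_holder φ h

theorem measurePreserving_neg : MeasurePreserving (fun θ : T => -θ) arc arc :=
  Measure.measurePreserving_neg arc

/-- The flip `J : L² → L²`, `(J h)(z) = z̄ h(z̄)`, that is `(J h)(θ) = e^{-iθ} h(-θ)`. -/
def flip : L2 →L[ℂ] L2 :=
  mulOp (fourierLp ∞ (-1)) ∘L
    (Lp.compMeasurePreservingₗᵢ ℂ (fun θ : T => -θ) measurePreserving_neg).toContinuousLinearMap

theorem coeFn_flip (h : L2) : flip h =ᵐ[arc] fun θ => fourier (-1) θ * h (-θ) := by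
  have h1 := coeFn_mulOp (fourierLp ∞ (-1))
    (Lp.compMeasurePreserving (fun θ : T => -θ) measurePreserving_neg h)
  have h2 := coeFn_fourierLp (T := 2 * Real.pi) ∞ (-1)
  have h3 := Lp.coeFn_compMeasurePreserving h measurePreserving_neg
  filter_upwards [h1, h2, h3] with θ h1 h2 h3
  rw [h2, h3] at h1
  exact h1

theorem fourierCoeff_flip (h : L2) (n : ℤ) :
    fourierCoeff (flip h) n = fourierCoeff h (-n - 1) := by
  rw [fourierCoeff_congr_ae (coeFn_flip h)]
  unfold fourierCoeff
  rw [← integral_neg_eq_self (μ := (arc : Measure T))]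
  refine integral_congr_ae (Eventually.of_forall fun θ => ?_)
  have e : ∀ m : ℤ, fourier m (-θ) = fourier (-m) θ := fun m => by simp [fourier_apply]
  simp only [e, neg_neg, smul_eq_mul, ← mul_assoc, ← fourier_add]
  congr 3
  ring

theorem flip_mem_H2 {h : L2} (hh : h ∈ H2ᗮ) : flip h ∈ H2 := by
  intro n hn
  rw [fourierCoeff_flip, fourierCoeff_eq_inner]
  refine (Submodule.mem_orthogonal _ _).1 hh _ fun m hm => ?_
  rw [fourierCoeff_eq_inner, (orthonormal_fourier (T := 2 * Real.pi)).inner_eq_zero]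
  omega

/-- The Hankel operator `Γ_φ = J R₋ M_φ` on `H²`. -/
def hankel (φ : LInfty) : H2 →L[ℂ] H2 :=
  (flip ∘L H2ᗮ.subtypeL ∘L Rminus ∘L mulOp φ ∘L H2.subtypeL).codRestrict H2
    fun h => flip_mem_H2 (Rminus (mulOp φ h)).2

/-- The kernel `(f(θ) g(φ) - f(φ) g(θ)) / (1 - e^{i(θ - φ)})`. -/
def kernel (f g : LInfty) (θ φ : T) : ℂ :=
  (f θ * g φ - f φ * g θ) / (1 - fourier 1 (θ - φ))

/-- `W` is the integral operator on `L²` with kernel `K`: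
`(W h)(θ) = p.v. (1 / 2π) ∫ K(θ, φ) h(φ) dφ` for every `h ∈ L²` and almost every `θ`.
The principal value on the diagonal is needed because a singularity of order `1 / (θ - φ)` is
not absolutely integrable in general. -/
def IsIntegralOperator (K : T → T → ℂ) (W : L2 →L[ℂ] L2) : Prop :=
  ∀ h : L2, ∀ᵐ θ ∂arc,
    Tendsto (fun ε : ℝ => ∫ φ in {φ : T | ε < ‖θ - φ‖}, K θ φ * h φ ∂arc)
      (𝓝[>] 0) (𝓝 (W h θ))

/-- `R₊ W R₊` as an operator on `H²`. -/
def compression (W : L2 →L[ℂ] L2) : H2 →L[ℂ] H2 := Rplus ∘L W ∘L H2.subtypeL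

end HankelCircle

end

noncomputable section

namespace HankelCircle

/-! Formally `1 / (1 - e^{it})` is `∑ n ≥ 0, e^{int}`, the kernel of `R₊`; its principal value is
`R₊ - 1/2`. The factors of `K` depending on `θ` alone come out of the integral, so the operator must
be `M_f (R₊ - 1/2) M_g - M_g (R₊ - 1/2) M_f`. The halves cancel because multiplications commute,
which leaves the bounded operator `W = M_f R₊ M_g - M_g R₊ M_f` (`commutatorOp`).

The analytic core is `ae_tendsto_truncated_cauchy`. The truncated Cauchy kernel at scale `ε` is
compared with the Abel kernel of radius `1 - ε`. Their difference is at most a constant times `min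
(1/ε) (ε/‖t‖²)`, so it annihilates mean-zero oscillation at Lebesgue points. The Abel means of `u`
are those of `R₊ u`, and they converge a.e. by the same estimate for the Poisson kernel. The
correction `1/2` is one minus the limiting mean `1/2` of the truncated kernel.

The rest is operator algebra. As `M_f* = M_g`, `W` is self-adjoint. `J` preserves inner products and
`R₋ = 1 - R₊`, so `Γ_φ*Γ_φ` compresses `M_φ* M_φ - M_φ* R₊ M_φ`; in the difference for `f` and `g`
the first terms cancel. For continuous `f`, trigonometric polynomials approximate the symbol
uniformly and give finite-rank Hankel operators, so `Γ_f` and `Γ_g` are compact. -/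

/-! ### Kernel estimates at a Lebesgue point -/

theorem exists_mul_average_bound {θ : T} {w : T → ℝ} (hw0 : ∀ φ, 0 ≤ w φ) (hw : Integrable w arc)
    (hL : Tendsto (fun δ : ℝ => δ⁻¹ * ∫ φ in Metric.closedBall θ δ, w φ ∂arc) (𝓝[>] 0) (𝓝 0)) :
    ∃ M : ℝ, ∀ δ : ℝ, 0 < δ → δ⁻¹ * ∫ φ in Metric.closedBall θ δ, w φ ∂arc ≤ M := by
  have h1 := hL.eventually (eventually_le_nhds (show (0 : ℝ) < 1 by norm_num))
  obtain ⟨δ₀, hδ₀, h2⟩ := (mem_nhdsGT_iff_exists_Ioo_subset).1 h1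
  refine ⟨max 1 (δ₀⁻¹ * ∫ φ, w φ ∂arc), fun δ hδ => ?_⟩
  rcases lt_or_ge δ δ₀ with h | h
  · exact le_max_of_le_left (h2 ⟨hδ, h⟩)
  · refine le_max_of_le_right ?_
    have hδ₀' : 0 < δ₀ := hδ₀
    have h3 : ∫ φ in Metric.closedBall θ δ, w φ ∂arc ≤ ∫ φ, w φ ∂arc :=
      setIntegral_le_integral hw (Eventually.of_forall hw0)
    have h4 : 0 ≤ ∫ φ in Metric.closedBall θ δ, w φ ∂arc :=
      integral_nonneg fun φ => hw0 φ
    gcongr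

/-- Kernels dominated by `min (1 / ε) (ε / ‖θ - φ‖ ^ 2)` annihilate, in the limit, functions with
vanishing mean at `θ`. -/
theorem tendsto_integral_zero_of_kernel_bound {θ : T} {w : T → ℝ} (hw0 : ∀ φ, 0 ≤ w φ)
    (hw : Integrable w arc)
    (hL : Tendsto (fun δ : ℝ => δ⁻¹ * ∫ φ in Metric.closedBall θ δ, w φ ∂arc) (𝓝[>] 0) (𝓝 0))
    {G : ℝ → T → ℂ} {C : ℝ} (hC : 0 ≤ C)
    (h1 : ∀ ε, 0 < ε → ε < 1 → ∀ φ, ‖G ε φ‖ * ε ≤ C * w φ)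
    (h2 : ∀ ε, 0 < ε → ε < 1 → ∀ φ, ‖G ε φ‖ * ‖θ - φ‖ ^ 2 ≤ C * ε * w φ) :
    Tendsto (fun ε => ∫ φ, G ε φ ∂arc) (𝓝[>] 0) (𝓝 0) := by
  obtain ⟨M, hM⟩ := exists_mul_average_bound hw0 hw hL
  set m : ℝ → ℝ := fun δ => δ⁻¹ * ∫ φ in Metric.closedBall θ δ, w φ ∂arc with hm
  have hm0 : ∀ δ, 0 < δ → 0 ≤ m δ := fun δ hδ =>
    mul_nonneg (inv_nonneg.2 hδ.le) (integral_nonneg fun φ => hw0 φ)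
  have hpos : ∀ (j : ℕ) (ε : ℝ), 0 < ε → 0 < 2 ^ j * ε := fun j ε hε => by positivity
  have hsum : Summable fun j : ℕ => 4 * C * M * (1 / 2 : ℝ) ^ j :=
    (summable_geometric_of_lt_one (by norm_num) (by norm_num)).mul_left _
  have hbd : ∀ ε, 0 < ε → ∀ j : ℕ,
      ‖4 * C * (1 / 2 : ℝ) ^ j * m (2 ^ j * ε)‖ ≤ 4 * C * M * (1 / 2 : ℝ) ^ j := by
    intro ε hε j
    rw [Real.norm_of_nonneg (mul_nonneg (by positivity) (hm0 _ (hpos j ε hε)))]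
    have := mul_le_mul_of_nonneg_left (hM _ (hpos j ε hε))
      (show 0 ≤ 4 * C * (1 / 2 : ℝ) ^ j by positivity)
    calc _ ≤ _ := this
      _ = _ := by ring
  -- Dominated convergence for series: each mean `m (2 ^ j * ε)` tends to `0`, and the uniform bound
  -- `M` gives a geometric majorant.
  have hlim : Tendsto (fun ε : ℝ => ∑' j : ℕ, 4 * C * (1 / 2 : ℝ) ^ j * m (2 ^ j * ε))
      (𝓝[>] 0) (𝓝 (∑' _ : ℕ, (0 : ℝ))) := by
    refine tendsto_tsum_of_dominated_convergence hsum (fun j => ?_) ?_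
    · have h3 : Tendsto (fun ε : ℝ => 2 ^ j * ε) (𝓝[>] 0) (𝓝[>] 0) := by
        refine tendsto_nhdsWithin_iff.2 ⟨?_, ?_⟩
        · have : Tendsto (fun ε : ℝ => 2 ^ j * ε) (𝓝 0) (𝓝 (2 ^ j * 0)) :=
            (continuous_const.mul continuous_id).tendsto 0
          rw [mul_zero] at this
          exact this.mono_left nhdsWithin_le_nhds
        · filter_upwards [self_mem_nhdsWithin] with ε hε using hpos j ε hε
      simpa using (hL.comp h3).const_mul (4 * C * (1 / 2 : ℝ) ^ j)
    · filter_upwards [self_mem_nhdsWithin] with ε hε j using hbd ε hε j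
  rw [tsum_zero] at hlim
  refine squeeze_zero_norm' ?_ hlim
  filter_upwards [self_mem_nhdsWithin, Ioo_mem_nhdsGT (show (0 : ℝ) < 1 by norm_num)]
    with ε hε hε1
  have hε : 0 < ε := hε
  obtain ⟨n, hn⟩ := pow_unbounded_of_one_lt (Real.pi / ε) (show (1 : ℝ) < 2 by norm_num)
  rw [div_lt_iff₀ hε] at hn
  have hpt : ∀ φ, ‖G ε φ‖ ≤ ∑ j ∈ Finset.range (n + 1),
      4 * C * (1 / 4 : ℝ) ^ j / ε * (Metric.closedBall θ (2 ^ j * ε)).indicator w φ := by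
    intro φ
    have hex : ∃ j : ℕ, ‖θ - φ‖ ≤ 2 ^ j * ε := by
      refine ⟨n, le_trans ?_ hn.le⟩
      have := AddCircle.norm_le_half_period (2 * Real.pi) (x := θ - φ) Real.two_pi_pos.ne'
      rw [abs_of_pos Real.two_pi_pos] at this
      linarith
    classical
    -- The least dyadic ball about `θ` containing `φ`: for `j = k + 1` the point lies outside radius
    -- `2 ^ k * ε`, so `h2` gains `(1/4) ^ k = 4 * (1/4) ^ j`. This is the origin of the constant
    -- `4`.
    set j := Nat.find hex with hj
    have hj1 : ‖θ - φ‖ ≤ 2 ^ j * ε := Nat.find_spec hex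
    have hjn : j ≤ n := by
      refine Nat.find_min' hex (le_trans ?_ hn.le)
      have := AddCircle.norm_le_half_period (2 * Real.pi) (x := θ - φ) Real.two_pi_pos.ne'
      rw [abs_of_pos Real.two_pi_pos] at this
      linarith
    have hterm : ‖G ε φ‖ ≤
        4 * C * (1 / 4 : ℝ) ^ j / ε * (Metric.closedBall θ (2 ^ j * ε)).indicator w φ := by
      rw [Set.indicator_of_mem (by rwa [Metric.mem_closedBall, dist_comm, dist_eq_norm]),
        div_mul_eq_mul_div, le_div_iff₀ hε]
      rcases Nat.eq_zero_or_pos j with h0 | h0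
      · rw [h0]
        have := h1 ε hε hε1.2 φ
        have := mul_nonneg hC (hw0 φ)
        simp only [pow_zero]
        linarith
      · obtain ⟨k, hk⟩ := Nat.exists_eq_succ_of_ne_zero h0.ne'
        have hk1 : 2 ^ k * ε < ‖θ - φ‖ := not_le.1 (Nat.find_min hex (by omega))
        have h3 := h2 ε hε hε1.2 φ
        have h4 : (2 ^ k * ε) ^ 2 ≤ ‖θ - φ‖ ^ 2 := by gcongr
        have h5 : ‖G ε φ‖ * (2 ^ k * ε) ^ 2 ≤ C * ε * w φ :=
          (mul_le_mul_of_nonneg_left h4 (norm_nonneg _)).trans h3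
        have h6 : ((1 : ℝ) / 4) ^ k * (2 ^ k) ^ 2 = 1 := by
          rw [← pow_mul, mul_comm k 2, pow_mul, ← mul_pow]; norm_num
        have h7 : ‖G ε φ‖ * ε * ε ≤ (C * (1 / 4) ^ k * w φ) * ε := by
          have := mul_le_mul_of_nonneg_left h5 (show (0 : ℝ) ≤ (1 / 4) ^ k by positivity)
          calc ‖G ε φ‖ * ε * ε = (1 / 4) ^ k * (2 ^ k) ^ 2 * (‖G ε φ‖ * ε * ε) := by
                rw [h6, one_mul]
            _ = (1 / 4) ^ k * (‖G ε φ‖ * (2 ^ k * ε) ^ 2) := by ring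
            _ ≤ _ := this
            _ = _ := by ring
        have h8 := le_of_mul_le_mul_right h7 hε
        rw [hk, pow_succ]
        linarith
    refine hterm.trans (Finset.single_le_sum (f := fun j : ℕ => 4 * C * (1 / 4 : ℝ) ^ j / ε *
      (Metric.closedBall θ (2 ^ j * ε)).indicator w φ) (fun i _ => ?_)
      (Finset.mem_range.2 (Nat.lt_succ_of_le hjn)))
    exact mul_nonneg (by positivity) (Set.indicator_nonneg (fun φ _ => hw0 φ) φ)
  have hint : ∀ j : ℕ, Integrable (fun φ => 4 * C * (1 / 4 : ℝ) ^ j / ε *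
      (Metric.closedBall θ (2 ^ j * ε)).indicator w φ) arc := fun j =>
    (hw.indicator Metric.isClosed_closedBall.measurableSet).const_mul _
  calc ‖∫ φ, G ε φ ∂arc‖
      ≤ ∫ φ, ∑ j ∈ Finset.range (n + 1), 4 * C * (1 / 4 : ℝ) ^ j / ε *
          (Metric.closedBall θ (2 ^ j * ε)).indicator w φ ∂arc :=
        norm_integral_le_of_norm_le (integrable_finsetSum _ fun j _ => hint j)
          (Eventually.of_forall hpt)
    _ = ∑ j ∈ Finset.range (n + 1), 4 * C * (1 / 2 : ℝ) ^ j * m (2 ^ j * ε) := by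
        rw [integral_finsetSum _ fun j _ => hint j]
        refine Finset.sum_congr rfl fun j _ => ?_
        rw [integral_const_mul, integral_indicator Metric.isClosed_closedBall.measurableSet, hm]
        -- One factor `2⁻ʲ`, together with `1 / ε`, normalises the integral over the ball of radius
        -- `2 ^ j * ε`; the other makes the series converge.
        have h6 : ((1 : ℝ) / 4) ^ j = (1 / 2) ^ j * (2 ^ j)⁻¹ := by
          rw [← inv_pow, ← mul_pow]; norm_num
        simp only [mul_inv, h6]
        ring
    _ ≤ _ := by
        refine Summable.sum_le_tsum _ (fun j _ => ?_) (Summable.of_norm_bounded hsum (hbd ε hε))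
        exact mul_nonneg (by positivity) (hm0 _ (hpos j ε hε))

/-! ### Lebesgue points on the circle -/

theorem setIntegral_volume_eq (s : Set T) (w : T → ℝ) :
    ∫ φ in s, w φ = (2 * Real.pi) * ∫ φ in s, w φ ∂arc := by
  rw [AddCircle.volume_eq_smul_haarAddCircle, Measure.restrict_smul, integral_smul_measure,
    ENNReal.toReal_ofReal Real.two_pi_pos.le, smul_eq_mul]

theorem ae_volume_iff {p : T → Prop} : (∀ᵐ θ, p θ) ↔ ∀ᵐ θ ∂arc, p θ := by
  rw [AddCircle.volume_eq_smul_haarAddCircle]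
  exact Measure.ae_ennreal_smul_measure_iff (by simp [Real.pi_pos])

/-- Almost every point of the circle is a Lebesgue point of an integrable function. -/
theorem ae_tendsto_mean_oscillation {u : T → ℂ} (hu : Integrable u arc) :
    ∀ᵐ θ ∂arc, Tendsto
      (fun δ : ℝ => δ⁻¹ * ∫ φ in Metric.closedBall θ δ, ‖u φ - u θ‖ ∂arc) (𝓝[>] 0) (𝓝 0) := by
  have hu' : Integrable u (volume : Measure T) := by
    rw [AddCircle.volume_eq_smul_haarAddCircle]
    exact hu.smul_measure ENNReal.ofReal_ne_top
  have h := IsUnifLocDoublingMeasure.ae_tendsto_average_norm_sub volume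
    hu'.locallyIntegrable 1
  filter_upwards [ae_volume_iff.1 h] with θ hθ
  have h1 := hθ (l := 𝓝[>] (0 : ℝ)) (fun _ => θ) (fun δ => δ) tendsto_id (by
    filter_upwards [self_mem_nhdsWithin] with δ hδ
    exact Metric.mem_closedBall_self (by rw [one_mul]; exact le_of_lt hδ))
  -- For `δ < π` the ball has length `2δ` and `arc` is length over `2π`, so the average is `π δ⁻¹ ∫
  -- … ∂arc`.
  have h2 := h1.const_mul (Real.pi⁻¹)
  rw [mul_zero] at h2
  refine h2.congr' ?_
  filter_upwards [self_mem_nhdsWithin, Ioo_mem_nhdsGT Real.pi_pos] with δ hδ hδ'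
  rw [setAverage_eq, setIntegral_volume_eq, measureReal_def, AddCircle.volume_closedBall,
    min_eq_right (by linarith [hδ'.2]), ENNReal.toReal_ofReal (by linarith [hδ'.1])]
  have : δ ≠ 0 := hδ'.1.ne'
  simp only [smul_eq_mul]
  field_simp

/-! ### Abel, Poisson and truncated Cauchy kernels -/

theorem norm_fourier_apply (n : ℤ) (t : T) : ‖fourier n t‖ = 1 := by
  rw [fourier_apply]; exact Circle.norm_coe _

/-- Jordan's inequality applied to `|1 - e^{ix}| = 2 sin (|x| / 2)` for `|x| ≤ π`. -/
theorem two_mul_norm_le (t : T) : 2 * ‖t‖ ≤ Real.pi * ‖1 - fourier 1 t‖ := by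
  have hp := Real.pi_pos
  have ht : t ∈ ((↑) : ℝ → T) '' Set.Ioc (-Real.pi) (-Real.pi + 2 * Real.pi) := by
    rw [AddCircle.coe_image_Ioc_eq]; trivial
  obtain ⟨x, hx, rfl⟩ := ht
  have hx' : |x| ≤ Real.pi := abs_le.2 ⟨hx.1.le, by linarith [hx.2]⟩
  rw [(AddCircle.norm_coe_eq_abs_iff (p := 2 * Real.pi) (x := x) Real.two_pi_pos.ne').2
    (by rw [abs_of_pos Real.two_pi_pos]; linarith)]
  have h1 : fourier 1 (x : T) = Complex.exp (Complex.I * x) := by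
    rw [fourier_coe_apply]
    congr 1
    have : (Real.pi : ℂ) ≠ 0 := Complex.ofReal_ne_zero.2 hp.ne'
    push_cast
    field_simp
  rw [h1, norm_sub_rev, Complex.norm_exp_I_mul_ofReal_sub_one, Real.norm_eq_abs, abs_mul,
    abs_of_pos (show (0 : ℝ) < 2 by norm_num)]
  have h2 : |Real.sin (x / 2)| = Real.sin (|x| / 2) := by
    rw [Real.abs_sin_eq_sin_abs_of_abs_le_pi, abs_div, abs_of_pos (show (0 : ℝ) < 2 by norm_num)]
    rw [abs_div, abs_of_pos (show (0 : ℝ) < 2 by norm_num)]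
    linarith
  have h3 := Real.mul_le_sin (x := |x| / 2) (by positivity) (by linarith)
  rw [h2]
  calc 2 * |x| = Real.pi * (2 * (2 / Real.pi * (|x| / 2))) := by field_simp
    _ ≤ _ := by gcongr

theorem one_sub_fourier_ne_zero {t : T} (ht : t ≠ 0) : 1 - fourier 1 t ≠ 0 := by
  intro h
  have := two_mul_norm_le t
  rw [h, norm_zero, mul_zero] at this
  exact ht (norm_le_zero_iff.1 (by linarith))

/-- The Abel kernel `∑ n ≥ 0, (1 - ε) ^ n e^{i s n t}`. -/
def abelKernel (s : ℤ) (ε : ℝ) (t : T) : ℂ := (1 - (1 - ε : ℝ) * fourier s t)⁻¹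

theorem norm_one_sub_fourier_ge {ε : ℝ} (h1 : ε < 1) (s : ℤ) (t : T) :
    ε ≤ ‖1 - ((1 - ε : ℝ) : ℂ) * fourier s t‖ := by
  have h := norm_sub_norm_le (1 : ℂ) (((1 - ε : ℝ) : ℂ) * fourier s t)
  rw [norm_mul, norm_fourier_apply, Complex.norm_real, Real.norm_of_nonneg (by linarith),
    norm_one] at h
  linarith

/-- Replacing `e^{it}` by `(1 - ε) e^{it}` moves `1 - e^{it}` by `ε`, which is itself at most the
new modulus; the resulting factor `2` cancels that of `two_mul_norm_le`. -/
theorem norm_le_norm_one_sub_fourier {ε : ℝ} (h0 : 0 < ε) (h1 : ε < 1) (t : T) :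
    ‖t‖ ≤ Real.pi * ‖1 - ((1 - ε : ℝ) : ℂ) * fourier 1 t‖ := by
  have h := norm_one_sub_fourier_ge h1 1 t
  have h2 := two_mul_norm_le t
  have h3 : ‖1 - fourier 1 t‖ ≤ ‖1 - ((1 - ε : ℝ) : ℂ) * fourier 1 t‖ + ε := by
    calc ‖1 - fourier 1 t‖
        = ‖(1 - ((1 - ε : ℝ) : ℂ) * fourier 1 t) - (ε : ℂ) * fourier 1 t‖ := by
          congr 1; push_cast; ring
      _ ≤ _ := norm_sub_le _ _
      _ = _ := by
          rw [norm_mul (ε : ℂ), norm_fourier_apply, Complex.norm_real, Real.norm_of_nonneg h0.le,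
            mul_one]
  have h4 : Real.pi * ‖1 - fourier 1 t‖ ≤
      Real.pi * (2 * ‖1 - ((1 - ε : ℝ) : ℂ) * fourier 1 t‖) := by
    have := Real.pi_pos
    gcongr
    linarith
  linarith

theorem norm_abelKernel_le {ε : ℝ} (h0 : 0 < ε) (h1 : ε < 1) (s : ℤ) (t : T) :
    ‖abelKernel s ε t‖ ≤ ε⁻¹ := by
  rw [abelKernel, norm_inv]
  exact inv_anti₀ h0 (norm_one_sub_fourier_ge h1 s t)

theorem measurable_abelKernel (s : ℤ) (ε : ℝ) : Measurable (abelKernel s ε) := by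
  unfold abelKernel
  exact (measurable_const.sub
    (measurable_const.mul (fourier s : C(T, ℂ)).continuous.measurable)).inv

theorem hasSum_integral_abelKernel {ε : ℝ} (h0 : 0 < ε) (h1 : ε < 1) (s : ℤ) {u : T → ℂ}
    (hu : Integrable u arc) (θ : T) :
    HasSum (fun n : ℕ => ((1 - ε : ℝ) : ℂ) ^ n * (fourier (s * n) θ * fourierCoeff u (s * n)))
      (∫ φ, abelKernel s ε (θ - φ) * u φ ∂arc) := by
  set r : ℝ := 1 - ε with hr
  have hr0 : 0 < r := by linarith
  have hr1 : r < 1 := by linarith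
  have hpow : ∀ (n : ℕ) (t : T), fourier (s * n) t = (fourier s t) ^ n := by
    intro n t
    induction n with
    | zero => simp
    | succ n ih =>
      rw [Nat.cast_succ, mul_add, mul_one, fourier_add, ih, pow_succ]
  set F : ℕ → T → ℂ := fun n φ => (r : ℂ) ^ n * (fourier (s * n) (θ - φ) * u φ) with hF
  have hcont : ∀ n : ℕ, Continuous fun φ : T => fourier (s * n) (θ - φ) := fun n => by fun_prop
  have hnorm : ∀ n φ, ‖F n φ‖ = r ^ n * ‖u φ‖ := by
    intro n φ
    rw [hF]
    simp only [norm_mul, norm_pow, norm_fourier_apply, Complex.norm_real,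
      Real.norm_of_nonneg hr0.le, one_mul]
  have hFint : ∀ n, Integrable (F n) arc := fun n =>
    (hu.bdd_mul (c := 1) (hcont n).aestronglyMeasurable
      (Eventually.of_forall fun φ => (norm_fourier_apply _ _).le)).const_mul _
  have hFsum : Summable fun n => ∫ φ, ‖F n φ‖ ∂arc := by
    simp only [hnorm, integral_const_mul]
    exact (summable_geometric_of_lt_one hr0.le hr1).mul_right _
  have h := hasSum_integral_of_summable_integral_norm hFint hFsum
  have h2 : (fun φ => ∑' n, F n φ) = fun φ => abelKernel s ε (θ - φ) * u φ := by
    funext φ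
    have hz : ‖(r : ℂ) * fourier s (θ - φ)‖ < 1 := by
      rw [norm_mul, norm_fourier_apply, Complex.norm_real, Real.norm_of_nonneg hr0.le, mul_one]
      exact hr1
    have := ((hasSum_geometric_of_norm_lt_one hz).mul_right (u φ)).tsum_eq
    rw [abelKernel, ← this]
    refine tsum_congr fun n => ?_
    simp only [hF, hpow, mul_pow, mul_assoc]
  rw [h2] at h
  refine h.congr_fun fun n => ?_
  simp only [hF, integral_const_mul]
  congr 1
  rw [fourierCoeff, ← integral_const_mul]
  refine integral_congr_ae (Eventually.of_forall fun φ => ?_)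
  simp only [smul_eq_mul, ← mul_assoc]
  congr 1
  rw [fourier_apply, fourier_apply, fourier_apply, ← Circle.coe_mul, ← AddCircle.toCircle_add,
    neg_smul, smul_sub, sub_eq_add_neg]

theorem integrable_coeFn (h : L2) : Integrable h arc :=
  (Lp.memLp h).integrable (by norm_num)

theorem fourierLp_mem_H2 {n : ℤ} (hn : 0 ≤ n) : (fourierLp 2 n : L2) ∈ H2 := by
  intro m hm
  rw [fourierCoeff_eq_inner, (orthonormal_fourier (T := 2 * Real.pi)).inner_eq_zero]
  omega

theorem fourierCoeff_Rplus (u : L2) {n : ℤ} (hn : 0 ≤ n) :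
    fourierCoeff (Rplus u : L2) n = fourierCoeff u n := by
  rw [fourierCoeff_eq_inner, fourierCoeff_eq_inner]
  have h := Submodule.sub_starProjection_mem_orthogonal (K := H2) u
  have h2 := (Submodule.mem_orthogonal _ _).1 h _ (fourierLp_mem_H2 hn)
  rw [inner_sub_right, sub_eq_zero] at h2
  exact h2.symm

theorem fourierCoeff_const (c : ℂ) (n : ℤ) :
    fourierCoeff (fun _ : T => c) n = if n = 0 then c else 0 := by
  have h := fourierCoeff_fourier (T := 2 * Real.pi) 0
  have h1 : (fun _ : T => c) = fun t : T => c * fourier 0 t := by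
    funext t; rw [fourier_zero, mul_one]
  rw [h1, fourierCoeff.const_mul, h]
  simp [Pi.single_apply]

theorem integrable_abelKernel_mul {ε : ℝ} (h0 : 0 < ε) (h1 : ε < 1) (s : ℤ) {u : T → ℂ}
    (hu : Integrable u arc) (θ : T) :
    Integrable (fun φ => abelKernel s ε (θ - φ) * u φ) arc :=
  hu.bdd_mul (c := ε⁻¹)
    ((measurable_abelKernel s ε).comp (measurable_const.sub measurable_id)).aestronglyMeasurable
    (Eventually.of_forall fun _ => norm_abelKernel_le h0 h1 _ _)

theorem integral_abelKernel_const {ε : ℝ} (h0 : 0 < ε) (h1 : ε < 1) {s : ℤ} (hs : s ≠ 0) (c : ℂ)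
    (θ : T) : ∫ φ, abelKernel s ε (θ - φ) * c ∂arc = c := by
  have h := hasSum_integral_abelKernel h0 h1 s (integrable_const c) θ
  refine h.unique ?_
  convert hasSum_single (f := fun n : ℕ => ((1 - ε : ℝ) : ℂ) ^ n *
    (fourier (s * n) θ * fourierCoeff (fun _ : T => c) (s * n))) 0 ?_ using 1
  · simp [fourierCoeff_const]
  · intro n hn
    simp [fourierCoeff_const, hs, hn]

/-- The kernel contains only frequencies `n ≥ 0`, where `u` and `R₊ u` have the same coefficients.
-/
theorem integral_abelKernel_Rplus {ε : ℝ} (h0 : 0 < ε) (h1 : ε < 1) (u : L2) (θ : T) :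
    ∫ φ, abelKernel 1 ε (θ - φ) * (Rplus u : L2) φ ∂arc
      = ∫ φ, abelKernel 1 ε (θ - φ) * u φ ∂arc := by
  refine (hasSum_integral_abelKernel h0 h1 1 (integrable_coeFn _) θ).unique ?_
  convert hasSum_integral_abelKernel h0 h1 1 (integrable_coeFn u) θ using 4 with n
  exact fourierCoeff_Rplus u (by positivity)

theorem integral_abelKernel_neg_of_mem_H2 {ε : ℝ} (h0 : 0 < ε) (h1 : ε < 1) {v : L2}
    (hv : v ∈ H2) (θ : T) :
    ∫ φ, abelKernel (-1) ε (θ - φ) * v φ ∂arc = ∫ φ, v φ ∂arc := by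
  refine (hasSum_integral_abelKernel h0 h1 (-1) (integrable_coeFn _) θ).unique ?_
  convert hasSum_single (f := fun n : ℕ => ((1 - ε : ℝ) : ℂ) ^ n *
    (fourier (-1 * n) θ * fourierCoeff v (-1 * n))) 0 ?_ using 1
  · simp [fourierCoeff]
  · intro n hn
    rw [mem_H2.1 hv _ (by omega), mul_zero, mul_zero]

/-- The Poisson kernel of radius `1 - ε`. -/
def poissonKernel (ε : ℝ) (t : T) : ℂ := abelKernel 1 ε t + abelKernel (-1) ε t - 1

/-- With `z = (1 - ε) e^{it}` the kernel is `(1 - |z|²) / |1 - z|²`, and `1 - (1 - ε)² ≤ 2ε`. -/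
theorem norm_poissonKernel_mul {ε : ℝ} (h0 : 0 < ε) (h1 : ε < 1) (t : T) :
    ‖poissonKernel ε t‖ * ‖1 - ((1 - ε : ℝ) : ℂ) * fourier 1 t‖ ^ 2 ≤ 2 * ε := by
  set z : ℂ := ((1 - ε : ℝ) : ℂ) * fourier 1 t with hz
  have hz' : ((1 - ε : ℝ) : ℂ) * fourier (-1) t = conj z := by
    rw [hz, fourier_neg, map_mul, Complex.conj_ofReal]
  have hne : 1 - z ≠ 0 := norm_pos_iff.1 (h0.trans_le (norm_one_sub_fourier_ge h1 1 t))
  have hne' : 1 - conj z ≠ 0 := by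
    rw [← hz']; exact norm_pos_iff.1 (h0.trans_le (norm_one_sub_fourier_ge h1 (-1) t))
  have hzn : z * conj z = ((1 - ε : ℝ) : ℂ) ^ 2 := by
    rw [Complex.mul_conj', hz, norm_mul, norm_fourier_apply, Complex.norm_real,
      Real.norm_of_nonneg (by linarith), mul_one]
  have hn : ‖1 - conj z‖ = ‖1 - z‖ := by
    rw [← Complex.norm_conj (1 - z), map_sub, map_one]
  have key : poissonKernel ε t * ((1 - z) * (1 - conj z)) = ((1 - (1 - ε) ^ 2 : ℝ) : ℂ) := by
    rw [poissonKernel, abelKernel, abelKernel, hz', ← hz]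
    have e : ((1 - z)⁻¹ + (1 - conj z)⁻¹ - 1) * ((1 - z) * (1 - conj z)) = 1 - z * conj z := by
      field_simp
      ring
    rw [e, hzn]
    push_cast
    ring
  have h2 := congrArg norm key
  rw [norm_mul, norm_mul, hn, Complex.norm_real, Real.norm_of_nonneg (by nlinarith), ← sq] at h2
  rw [h2]
  nlinarith

theorem norm_poissonKernel_le {ε : ℝ} (h0 : 0 < ε) (h1 : ε < 1) (t : T) :
    ‖poissonKernel ε t‖ * ε ≤ 2 := by
  have h := norm_poissonKernel_mul h0 h1 t
  have h2 := norm_one_sub_fourier_ge h1 1 t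
  have h3 : ‖poissonKernel ε t‖ * ε ^ 2 ≤ 2 * ε := h.trans' (by gcongr)
  exact le_of_mul_le_mul_right (by linarith) h0

theorem norm_poissonKernel_mul_norm_sq_le {ε : ℝ} (h0 : 0 < ε) (h1 : ε < 1) (t : T) :
    ‖poissonKernel ε t‖ * ‖t‖ ^ 2 ≤ 2 * Real.pi ^ 2 * ε := by
  have h := norm_poissonKernel_mul h0 h1 t
  have h2 := norm_le_norm_one_sub_fourier h0 h1 t
  calc _ ≤ ‖poissonKernel ε t‖ * (Real.pi * ‖1 - ((1 - ε : ℝ) : ℂ) * fourier 1 t‖) ^ 2 := by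
        gcongr
    _ = Real.pi ^ 2 *
        (‖poissonKernel ε t‖ * ‖1 - ((1 - ε : ℝ) : ℂ) * fourier 1 t‖ ^ 2) := by ring
    _ ≤ Real.pi ^ 2 * (2 * ε) := by gcongr
    _ = _ := by ring

/-- The Abel kernel minus the truncated kernel `1 / (1 - e^{it})`. -/
def defectKernel (ε : ℝ) (t : T) : ℂ :=
  abelKernel 1 ε t - {t : T | ε < ‖t‖}.indicator (fun t => (1 - fourier 1 t)⁻¹) t

theorem norm_inv_one_sub_fourier_le {ε : ℝ} (h0 : 0 < ε) {t : T} (ht : ε < ‖t‖) :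
    ‖(1 - fourier 1 t)⁻¹‖ ≤ Real.pi * ε⁻¹ := by
  have h := two_mul_norm_le t
  have hne : 0 < ‖1 - fourier 1 t‖ := by
    rw [norm_pos_iff]
    exact one_sub_fourier_ne_zero (norm_pos_iff.1 (h0.trans ht))
  rw [norm_inv, ← div_eq_mul_inv, le_div_iff₀ h0, inv_mul_le_iff₀ hne]
  linarith

theorem norm_truncated_le {ε : ℝ} (h0 : 0 < ε) (t : T) :
    ‖{t : T | ε < ‖t‖}.indicator (fun t => (1 - fourier 1 t)⁻¹) t‖ ≤ Real.pi * ε⁻¹ := by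
  by_cases ht : ε < ‖t‖
  · rw [Set.indicator_of_mem (by exact ht)]
    exact norm_inv_one_sub_fourier_le h0 ht
  · rw [Set.indicator_of_notMem (by exact ht), norm_zero]
    have := Real.pi_pos
    positivity

theorem norm_defectKernel_le {ε : ℝ} (h0 : 0 < ε) (h1 : ε < 1) (t : T) :
    ‖defectKernel ε t‖ * ε ≤ 1 + Real.pi := by
  rw [← le_div_iff₀ h0, add_div, one_div, div_eq_mul_inv]
  exact (norm_sub_le _ _).trans (add_le_add (norm_abelKernel_le h0 h1 1 t) (norm_truncated_le h0 t))

/-- Off the truncated zone the difference of the two fractions is `-ε e^{it}` over the product of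
denominators, each at least of order `‖t‖`. Inside it only the Abel kernel remains, bounded by `1 /
ε`, while `‖t‖ ≤ ε`. -/
theorem norm_defectKernel_mul_norm_sq_le {ε : ℝ} (h0 : 0 < ε) (h1 : ε < 1) (t : T) :
    ‖defectKernel ε t‖ * ‖t‖ ^ 2 ≤ Real.pi ^ 2 * ε := by
  have hpi := Real.pi_gt_three
  by_cases ht : ε < ‖t‖
  · have hne : 1 - fourier 1 t ≠ 0 := one_sub_fourier_ne_zero (norm_pos_iff.1 (h0.trans ht))
    have hne' : 1 - ((1 - ε : ℝ) : ℂ) * fourier 1 t ≠ 0 :=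
      norm_pos_iff.1 (h0.trans_le (norm_one_sub_fourier_ge h1 1 t))
    have e : defectKernel ε t * ((1 - ((1 - ε : ℝ) : ℂ) * fourier 1 t) * (1 - fourier 1 t)) =
        -(ε * fourier 1 t) := by
      rw [defectKernel, Set.indicator_of_mem (by exact ht), abelKernel, sub_mul,
        inv_mul_cancel_left₀ hne', mul_comm _ (1 - fourier 1 t), inv_mul_cancel_left₀ hne]
      push_cast
      ring
    have e2 := congrArg norm e
    rw [norm_mul, norm_mul, norm_neg, norm_mul, norm_fourier_apply, Complex.norm_real,
      Real.norm_of_nonneg h0.le, mul_one] at e2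
    have h2 := norm_le_norm_one_sub_fourier h0 h1 t
    have h3 := two_mul_norm_le t
    calc ‖defectKernel ε t‖ * ‖t‖ ^ 2 = ‖defectKernel ε t‖ * (‖t‖ * ‖t‖) := by rw [sq]
      _ ≤ ‖defectKernel ε t‖ * ((Real.pi * ‖1 - ((1 - ε : ℝ) : ℂ) * fourier 1 t‖) *
          (Real.pi * ‖1 - fourier 1 t‖)) := by
          gcongr
          linarith [norm_nonneg t]
      _ = Real.pi ^ 2 * (‖defectKernel ε t‖ * (‖1 - ((1 - ε : ℝ) : ℂ) * fourier 1 t‖ *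
          ‖1 - fourier 1 t‖)) := by ring
      _ = _ := by rw [e2]
  · have ht' := not_lt.1 ht
    rw [defectKernel, Set.indicator_of_notMem (by exact ht), sub_zero]
    calc _ ≤ ε⁻¹ * ε ^ 2 := by
          gcongr
          exact norm_abelKernel_le h0 h1 1 t
      _ = ε := by field_simp
      _ = 1 * ε := (one_mul ε).symm
      _ ≤ _ := by gcongr; nlinarith

theorem measurableSet_lt_norm (ε : ℝ) : MeasurableSet {t : T | ε < ‖t‖} :=
  measurableSet_lt measurable_const measurable_norm

theorem measurable_truncated (ε : ℝ) :
    Measurable ({t : T | ε < ‖t‖}.indicator fun t => (1 - fourier 1 t)⁻¹) :=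
  (measurable_const.sub (fourier 1 : C(T, ℂ)).continuous.measurable).inv.indicator
    (measurableSet_lt_norm ε)

theorem integrable_truncated_mul {ε : ℝ} (h0 : 0 < ε) {u : T → ℂ} (hu : Integrable u arc) (θ : T) :
    Integrable (fun φ =>
      {t : T | ε < ‖t‖}.indicator (fun t => (1 - fourier 1 t)⁻¹) (θ - φ) * u φ) arc :=
  hu.bdd_mul (c := Real.pi * ε⁻¹)
    ((measurable_truncated ε).comp (measurable_const.sub measurable_id)).aestronglyMeasurable
    (Eventually.of_forall fun _ => norm_truncated_le h0 _)

theorem integrable_truncated {ε : ℝ} (h0 : 0 < ε) :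
    Integrable ({t : T | ε < ‖t‖}.indicator fun t => (1 - fourier 1 t)⁻¹) arc :=
  .of_bound (measurable_truncated ε).aestronglyMeasurable _
    (Eventually.of_forall fun _ => norm_truncated_le h0 _)

theorem arc_real_closedBall {ε : ℝ} (h0 : 0 < ε) (h1 : ε < Real.pi) :
    arc.real (Metric.closedBall (0 : T) ε) = ε / Real.pi := by
  have hpi := Real.pi_pos
  have h := setIntegral_volume_eq (Metric.closedBall (0 : T) ε) fun _ => 1
  simp only [integral_const, smul_eq_mul, mul_one, measureReal_restrict_apply_univ] at h
  rw [measureReal_def, AddCircle.volume_closedBall, min_eq_right (by linarith),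
    ENNReal.toReal_ofReal (by linarith)] at h
  rw [eq_div_iff hpi.ne']
  linarith

/-- For `|a| = 1`, `a ≠ 1`, one has `1 / (1 - a) + 1 / (1 - a⁻¹) = 1`; this symmetry yields the mean
of the truncated kernel. -/
theorem truncated_add_truncated_neg {ε : ℝ} (h0 : 0 < ε) (t : T) :
    {t : T | ε < ‖t‖}.indicator (fun t => (1 - fourier 1 t)⁻¹) t +
      {t : T | ε < ‖t‖}.indicator (fun t => (1 - fourier 1 t)⁻¹) (-t) =
      ((1 - (Metric.closedBall (0 : T) ε).indicator (fun _ => (1 : ℝ)) t : ℝ) : ℂ) := by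
  by_cases ht : ε < ‖t‖
  · have hne : 1 - fourier 1 t ≠ 0 := one_sub_fourier_ne_zero (norm_pos_iff.1 (h0.trans ht))
    have hne' : 1 - fourier 1 (-t) ≠ 0 :=
      one_sub_fourier_ne_zero (norm_pos_iff.1 (by rw [norm_neg]; exact h0.trans ht))
    have hmul : fourier 1 t * fourier 1 (-t) = 1 := by
      rw [fourier_apply, fourier_apply, ← Circle.coe_mul, ← AddCircle.toCircle_add]
      simp
    rw [Set.indicator_of_mem (by exact ht),
      Set.indicator_of_mem (by rw [Set.mem_ofPred_eq, norm_neg]; exact ht),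
      Set.indicator_of_notMem (by rw [mem_closedBall_zero_iff]; exact not_le.2 ht),
      sub_zero, Complex.ofReal_one, ← sub_eq_zero]
    generalize fourier 1 t = a at *
    generalize fourier 1 (-t) = b at *
    field_simp
    linear_combination (-1 : ℂ) * hmul
  · rw [Set.indicator_of_notMem (by exact ht),
      Set.indicator_of_notMem (by rw [Set.mem_ofPred_eq, norm_neg]; exact ht),
      Set.indicator_of_mem (by rw [mem_closedBall_zero_iff]; exact not_lt.1 ht)]
    simp

theorem two_mul_integral_truncated {ε : ℝ} (h0 : 0 < ε) (h1 : ε < Real.pi) :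
    2 * ∫ t, {t : T | ε < ‖t‖}.indicator (fun t => (1 - fourier 1 t)⁻¹) t ∂arc =
      ((1 - ε / Real.pi : ℝ) : ℂ) := by
  have hki := integrable_truncated h0
  have hsym := truncated_add_truncated_neg h0
  generalize ({t : T | ε < ‖t‖}.indicator fun t => (1 - fourier 1 t)⁻¹) = k at *
  have hneg : ∫ t, k (-t) ∂arc = ∫ t, k t ∂arc := integral_neg_eq_self k arc
  have hkin : Integrable (fun t => k (-t)) arc :=
    measurePreserving_neg.integrable_comp_of_integrable hki
  have hb : MeasurableSet (Metric.closedBall (0 : T) ε) := Metric.isClosed_closedBall.measurableSet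
  calc 2 * ∫ t, k t ∂arc = ∫ t, k t ∂arc + ∫ t, k (-t) ∂arc := by rw [hneg, two_mul]
    _ = ∫ t, ((1 - (Metric.closedBall (0 : T) ε).indicator (fun _ => (1 : ℝ)) t : ℝ) : ℂ) ∂arc := by
        rw [← integral_add hki hkin]
        exact integral_congr_ae (Eventually.of_forall hsym)
    _ = ((∫ t, (1 - (Metric.closedBall (0 : T) ε).indicator (fun _ => (1 : ℝ)) t) ∂arc : ℝ) : ℂ) :=
        integral_complex_ofReal
    _ = _ := by
        rw [integral_sub (integrable_const _) ((integrable_const _).indicator hb),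
          integral_indicator hb, integral_const, integral_const, measureReal_restrict_apply_univ,
          arc_real_closedBall h0 h1, probReal_univ]
        simp

theorem tendsto_integral_truncated :
    Tendsto (fun ε : ℝ => ∫ t, {t : T | ε < ‖t‖}.indicator (fun t => (1 - fourier 1 t)⁻¹) t ∂arc)
      (𝓝[>] 0) (𝓝 (1 / 2)) := by
  have h : Tendsto (fun ε : ℝ => (1 / 2 : ℂ) * ((1 - ε / Real.pi : ℝ) : ℂ)) (𝓝[>] 0)
      (𝓝 ((1 / 2 : ℂ) * ((1 - 0 / Real.pi : ℝ) : ℂ))) := by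
    refine Tendsto.mono_left ?_ nhdsWithin_le_nhds
    exact Continuous.tendsto (by fun_prop) 0
  rw [zero_div, sub_zero, Complex.ofReal_one, mul_one] at h
  refine h.congr' ?_
  filter_upwards [Ioo_mem_nhdsGT Real.pi_pos] with ε hε
  rw [← two_mul_integral_truncated hε.1 hε.2]
  ring

/-! ### Almost everywhere limits and the principal value -/

theorem ae_tendsto_integral_kernel_mul_sub {u : T → ℂ} (hu : Integrable u arc)
    {N : ℝ → T → ℂ} {C : ℝ} (hC : 0 ≤ C)
    (h1 : ∀ ε, 0 < ε → ε < 1 → ∀ t, ‖N ε t‖ * ε ≤ C)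
    (h2 : ∀ ε, 0 < ε → ε < 1 → ∀ t, ‖N ε t‖ * ‖t‖ ^ 2 ≤ C * ε) :
    ∀ᵐ θ ∂arc, Tendsto (fun ε => ∫ φ, N ε (θ - φ) * (u φ - u θ) ∂arc) (𝓝[>] 0) (𝓝 0) := by
  filter_upwards [ae_tendsto_mean_oscillation hu] with θ hθ
  refine tendsto_integral_zero_of_kernel_bound (w := fun φ => ‖u φ - u θ‖)
    (fun _ => norm_nonneg _) (hu.sub (integrable_const _)).norm hθ hC ?_ ?_
  · intro ε h0 hε φ
    rw [norm_mul, mul_right_comm]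
    exact mul_le_mul_of_nonneg_right (h1 ε h0 hε _) (norm_nonneg _)
  · intro ε h0 hε φ
    rw [norm_mul, mul_right_comm]
    exact mul_le_mul_of_nonneg_right (h2 ε h0 hε _) (norm_nonneg _)

/-- The Abel means of a function in `H²` converge to it almost everywhere. -/
theorem ae_tendsto_integral_abelKernel {v : L2} (hv : v ∈ H2) :
    ∀ᵐ θ ∂arc, Tendsto (fun ε => ∫ φ, abelKernel 1 ε (θ - φ) * v φ ∂arc) (𝓝[>] 0) (𝓝 (v θ)) := by
  have hvi := integrable_coeFn v
  have hpi := Real.pi_gt_three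
  filter_upwards [ae_tendsto_integral_kernel_mul_sub hvi (N := poissonKernel)
    (C := 2 * Real.pi ^ 2) (by positivity)
    (fun ε h0 h1 t => (norm_poissonKernel_le h0 h1 t).trans (by nlinarith))
    (fun ε h0 h1 t => norm_poissonKernel_mul_norm_sq_le h0 h1 t)] with θ hθ
  have h := hθ.add_const (v θ)
  rw [zero_add] at h
  refine h.congr' ?_
  filter_upwards [Ioo_mem_nhdsGT (show (0 : ℝ) < 1 by norm_num)] with ε hε
  have hi : ∀ s (u : T → ℂ), Integrable u arc →
      Integrable (fun φ => abelKernel s ε (θ - φ) * u φ) arc :=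
    fun s u hu => integrable_abelKernel_mul hε.1 hε.2 s hu θ
  have hP : ∀ u : T → ℂ, Integrable u arc → ∫ φ, poissonKernel ε (θ - φ) * u φ ∂arc =
      (∫ φ, abelKernel 1 ε (θ - φ) * u φ ∂arc) + (∫ φ, abelKernel (-1) ε (θ - φ) * u φ ∂arc) -
        ∫ φ, u φ ∂arc := by
    intro u hu
    have h2 : Integrable (fun φ => abelKernel 1 ε (θ - φ) * u φ + abelKernel (-1) ε (θ - φ) * u φ)
      arc := (hi 1 u hu).add (hi (-1) u hu)
    rw [← integral_add (hi 1 u hu) (hi (-1) u hu), ← integral_sub h2 hu]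
    refine integral_congr_ae (Eventually.of_forall fun φ => ?_)
    simp only [poissonKernel]
    ring
  have hPi : ∀ u : T → ℂ, Integrable u arc →
      Integrable (fun φ => poissonKernel ε (θ - φ) * u φ) arc := by
    intro u hu
    refine (((hi 1 u hu).add (hi (-1) u hu)).sub hu).congr (Eventually.of_forall fun φ => ?_)
    simp only [poissonKernel, Pi.add_apply, Pi.sub_apply]
    ring
  simp only [mul_sub]
  -- For `v ∈ H²` the reflected Abel kernel contributes only `∫ v`, which the `-1` in the Poisson
  -- kernel cancels.
  rw [integral_sub (hPi v hvi) (hPi _ (integrable_const _)), hP v hvi, hP _ (integrable_const _),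
    integral_abelKernel_neg_of_mem_H2 hε.1 hε.2 hv,
    integral_abelKernel_const hε.1 hε.2 one_ne_zero,
    integral_abelKernel_const hε.1 hε.2 (by norm_num), integral_const, probReal_univ, one_smul]
  ring

/-- The principal value of the Cauchy integral on the circle: it is `R₊ - 1 / 2`. -/
theorem ae_tendsto_truncated_cauchy (u : L2) :
    ∀ᵐ θ ∂arc, Tendsto
      (fun ε : ℝ => ∫ φ in {φ : T | ε < ‖θ - φ‖}, u φ / (1 - fourier 1 (θ - φ)) ∂arc)
      (𝓝[>] 0) (𝓝 ((Rplus u : L2) θ - u θ / 2)) := by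
  have hu := integrable_coeFn u
  have hpi := Real.pi_gt_three
  filter_upwards [ae_tendsto_integral_abelKernel (Rplus u).2,
    ae_tendsto_integral_kernel_mul_sub hu (N := defectKernel)
    (C := Real.pi ^ 2) (by positivity)
    (fun ε h0 h1 t => (norm_defectKernel_le h0 h1 t).trans (by nlinarith))
    (fun ε h0 h1 t => norm_defectKernel_mul_norm_sq_le h0 h1 t)] with θ hA hD
  -- With `A`, `D`, `k` the Abel, defect and truncated kernels and `∫ A = 1`, the truncated integral
  -- of `u` is `∫ A u - ∫ D (u - u θ) - (1 - ∫ k) u θ`.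
  have h := (hA.sub hD).sub ((tendsto_const_nhds (x := (1 : ℂ))).sub
    tendsto_integral_truncated |>.mul_const (u θ))
  have e : (Rplus u : L2) θ - 0 - (1 - 1 / 2) * u θ = (Rplus u : L2) θ - u θ / 2 := by ring
  rw [e] at h
  refine h.congr' ?_
  filter_upwards [Ioo_mem_nhdsGT (show (0 : ℝ) < 1 by norm_num)] with ε hε
  rw [integral_abelKernel_Rplus hε.1 hε.2]
  have hset : MeasurableSet {φ : T | ε < ‖θ - φ‖} :=
    (measurableSet_lt_norm ε).preimage (measurable_const.sub measurable_id)
  have htr : ∫ φ in {φ : T | ε < ‖θ - φ‖}, u φ / (1 - fourier 1 (θ - φ)) ∂arc =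
      ∫ φ, {t : T | ε < ‖t‖}.indicator (fun t => (1 - fourier 1 t)⁻¹) (θ - φ) * u φ ∂arc := by
    rw [← integral_indicator hset]
    refine integral_congr_ae (Eventually.of_forall fun φ => ?_)
    by_cases hφ : ε < ‖θ - φ‖
    · simp only [Set.indicator_of_mem (show φ ∈ {φ : T | ε < ‖θ - φ‖} from hφ),
        Set.indicator_of_mem (show θ - φ ∈ {t : T | ε < ‖t‖} from hφ), div_eq_inv_mul]
    · simp only [Set.indicator_of_notMem (show φ ∉ {φ : T | ε < ‖θ - φ‖} from hφ),
        Set.indicator_of_notMem (show θ - φ ∉ {t : T | ε < ‖t‖} from hφ), zero_mul]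
  have hc : ∫ φ, {t : T | ε < ‖t‖}.indicator (fun t => (1 - fourier 1 t)⁻¹) (θ - φ) * u θ ∂arc =
      (∫ t, {t : T | ε < ‖t‖}.indicator (fun t => (1 - fourier 1 t)⁻¹) t ∂arc) * u θ := by
    rw [integral_mul_const]
    congr 1
    exact integral_sub_left_eq_self
      ({t : T | ε < ‖t‖}.indicator fun t => (1 - fourier 1 t)⁻¹) arc θ
  have hAi : ∀ v : T → ℂ, Integrable v arc →
      Integrable (fun φ => abelKernel 1 ε (θ - φ) * v φ) arc :=
    fun v hv => integrable_abelKernel_mul hε.1 hε.2 1 hv θ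
  have hKi : ∀ v : T → ℂ, Integrable v arc → Integrable (fun φ =>
      {t : T | ε < ‖t‖}.indicator (fun t => (1 - fourier 1 t)⁻¹) (θ - φ) * v φ) arc :=
    fun v hv => integrable_truncated_mul hε.1 hv θ
  have hDi : ∀ v : T → ℂ, Integrable v arc → Integrable (fun φ =>
      abelKernel 1 ε (θ - φ) * v φ -
        {t : T | ε < ‖t‖}.indicator (fun t => (1 - fourier 1 t)⁻¹) (θ - φ) * v φ) arc :=
    fun v hv => (hAi v hv).sub (hKi v hv)
  simp only [defectKernel, sub_mul, mul_sub]
  rw [integral_sub (hDi u hu) (hDi _ (integrable_const _)), integral_sub (hAi u hu) (hKi u hu),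
    integral_sub (hAi _ (integrable_const _)) (hKi _ (integrable_const _)),
    integral_abelKernel_const hε.1 hε.2 one_ne_zero, hc, htr]
  ring

/-! ### The operator and its compression -/

theorem adjoint_mulOp {f g : LInfty} (hfg : ∀ᵐ θ ∂arc, conj (f θ) = g θ) :
    ContinuousLinearMap.adjoint (mulOp f) = mulOp g := by
  refine ((ContinuousLinearMap.eq_adjoint_iff _ _).2 fun x y => ?_).symm
  rw [L2.inner_def, L2.inner_def]
  refine integral_congr_ae ?_
  filter_upwards [coeFn_mulOp g x, coeFn_mulOp f y, hfg] with θ h1 h2 h3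
  rw [h1, h2, ← h3]
  simp only [RCLike.inner_apply, map_mul, Complex.conj_conj]
  ring

theorem mulOp_comm (f g : LInfty) (x : L2) : mulOp f (mulOp g x) = mulOp g (mulOp f x) := by
  refine Lp.ext ?_
  filter_upwards [coeFn_mulOp f x, coeFn_mulOp g x, coeFn_mulOp f (mulOp g x),
    coeFn_mulOp g (mulOp f x)] with θ h1 h2 h3 h4
  rw [h3, h4, h1, h2]
  ring

theorem inner_flip_flip (a b : L2) : inner ℂ (flip a) (flip b) = inner ℂ a b := by
  rw [L2.inner_def, L2.inner_def, ← integral_neg_eq_self (μ := (arc : Measure T))]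
  refine integral_congr_ae ?_
  have h (c : L2) := measurePreserving_neg.quasiMeasurePreserving.ae (coeFn_flip c)
  filter_upwards [h a, h b] with θ h1 h2
  have h3 : fourier (-1) (-θ) * conj (fourier (-1) (-θ)) = (1 : ℂ) := by
    rw [Complex.mul_conj', norm_fourier_apply, Complex.ofReal_one, one_pow]
  rw [h1, h2, neg_neg]
  simp only [RCLike.inner_apply, map_mul]
  linear_combination (b θ * conj (a θ)) * h3

theorem coe_Rminus (u : L2) : (Rminus u : L2) = u - Rplus u :=
  Submodule.starProjection_orthogonal_val u

theorem coe_hankel (φ : LInfty) (h : H2) :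
    (hankel φ h : L2) = flip (Rminus (mulOp φ h) : L2) := rfl

theorem inner_hankel_hankel (φ : LInfty) (x y : H2) :
    inner ℂ (hankel φ y) (hankel φ x) =
      inner ℂ (mulOp φ y) (mulOp φ x) - inner ℂ (mulOp φ y) (Rplus (mulOp φ x) : L2) := by
  rw [Submodule.coe_inner, coe_hankel, coe_hankel, inner_flip_flip, ← Submodule.coe_inner, Rminus,
    Submodule.inner_orthogonalProjectionOnto_eq_of_mem_right, ← Rminus, coe_Rminus,
    inner_sub_right]

/-- The bounded operator `M_f R₊ M_g - M_g R₊ M_f`. -/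
def commutatorOp (f g : LInfty) : L2 →L[ℂ] L2 :=
  mulOp f ∘L H2.starProjection ∘L mulOp g - mulOp g ∘L H2.starProjection ∘L mulOp f

theorem commutatorOp_apply (f g : LInfty) (h : L2) :
    commutatorOp f g h =
      mulOp f (Rplus (mulOp g h) : L2) - mulOp g (Rplus (mulOp f h) : L2) := rfl

theorem isSelfAdjoint_commutatorOp {f g : LInfty} (hfg : ∀ᵐ θ ∂arc, conj (f θ) = g θ) :
    IsSelfAdjoint (commutatorOp f g) := by
  have hf := adjoint_mulOp hfg
  have hg : ContinuousLinearMap.adjoint (mulOp g) = mulOp f := by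
    rw [← hf, ContinuousLinearMap.adjoint_adjoint]
  have hP : ContinuousLinearMap.adjoint H2.starProjection = H2.starProjection :=
    isSelfAdjoint_starProjection H2
  rw [isSelfAdjoint_iff, ContinuousLinearMap.star_eq_adjoint, commutatorOp, map_sub]
  simp only [ContinuousLinearMap.adjoint_comp, hf, hg, hP, ContinuousLinearMap.comp_assoc]

theorem compression_commutatorOp {f g : LInfty} (hfg : ∀ᵐ θ ∂arc, conj (f θ) = g θ) :
    compression (commutatorOp f g) =
      ContinuousLinearMap.adjoint (hankel f) ∘L hankel f -
        ContinuousLinearMap.adjoint (hankel g) ∘L hankel g := by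
  have hf := adjoint_mulOp hfg
  have hg : ContinuousLinearMap.adjoint (mulOp g) = mulOp f := by
    rw [← hf, ContinuousLinearMap.adjoint_adjoint]
  ext1 x
  refine ext_inner_left ℂ fun y => ?_
  have h1 : inner ℂ y (compression (commutatorOp f g) x) =
      inner ℂ (y : L2) (commutatorOp f g x) :=
    Submodule.inner_orthogonalProjectionOnto_eq_of_mem_left y _
  -- `M_f` is normal with adjoint `M_g`; these are the terms that cancel between the two Hankel
  -- squares.
  have h2 : inner ℂ (mulOp f (y : L2)) (mulOp f (x : L2)) =
      inner ℂ (mulOp g (y : L2)) (mulOp g (x : L2)) := by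
    rw [← ContinuousLinearMap.adjoint_inner_right, ← ContinuousLinearMap.adjoint_inner_right,
      hf, hg, mulOp_comm]
  rw [h1, commutatorOp_apply, inner_sub_right, ← hg, ContinuousLinearMap.adjoint_inner_right, hg,
    ← hf, ContinuousLinearMap.adjoint_inner_right, sub_apply, inner_sub_right,
    ContinuousLinearMap.comp_apply, ContinuousLinearMap.comp_apply,
    ContinuousLinearMap.adjoint_inner_right, ContinuousLinearMap.adjoint_inner_right,
    inner_hankel_hankel, inner_hankel_hankel, h2]
  rw [hf]
  ring

theorem isIntegralOperator_commutatorOp (f g : LInfty) :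
    IsIntegralOperator (kernel f g) (commutatorOp f g) := by
  intro h
  have hsub := Lp.coeFn_sub (mulOp f (Rplus (mulOp g h) : L2)) (mulOp g (Rplus (mulOp f h) : L2))
  filter_upwards [ae_tendsto_truncated_cauchy (mulOp g h), ae_tendsto_truncated_cauchy (mulOp f h),
    hsub, coeFn_mulOp f h, coeFn_mulOp g h, coeFn_mulOp f (Rplus (mulOp g h) : L2),
    coeFn_mulOp g (Rplus (mulOp f h) : L2)] with θ hg hf h1 h2 h3 h4 h5
  -- The halves inserted here cancel, both being `f g h / 2` at `θ`.
  have hW : commutatorOp f g h θ =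
      f θ * ((Rplus (mulOp g h) : L2) θ - mulOp g h θ / 2) -
        g θ * ((Rplus (mulOp f h) : L2) θ - mulOp f h θ / 2) := by
    rw [commutatorOp_apply, h1, Pi.sub_apply, h4, h5, h2, h3]
    ring
  rw [hW]
  refine ((hg.const_mul (f θ)).sub (hf.const_mul (g θ))).congr' ?_
  filter_upwards [self_mem_nhdsWithin] with ε hε
  have hset : MeasurableSet {φ : T | ε < ‖θ - φ‖} :=
    (measurableSet_lt_norm ε).preimage (measurable_const.sub measurable_id)
  have hi : ∀ u : L2, Integrable (fun φ => u φ / (1 - fourier 1 (θ - φ)))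
      (arc.restrict {φ : T | ε < ‖θ - φ‖}) := by
    intro u
    rw [← IntegrableOn, ← integrable_indicator_iff hset]
    refine (integrable_truncated_mul hε (integrable_coeFn u) θ).congr
      (Eventually.of_forall fun φ => ?_)
    by_cases hφ : ε < ‖θ - φ‖
    · simp only [Set.indicator_of_mem (show φ ∈ {φ : T | ε < ‖θ - φ‖} from hφ),
        Set.indicator_of_mem (show θ - φ ∈ {t : T | ε < ‖t‖} from hφ), div_eq_inv_mul]
    · simp only [Set.indicator_of_notMem (show φ ∉ {φ : T | ε < ‖θ - φ‖} from hφ),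
        Set.indicator_of_notMem (show θ - φ ∉ {t : T | ε < ‖t‖} from hφ), zero_mul]
  rw [← integral_const_mul, ← integral_const_mul,
    ← integral_sub ((hi _).const_mul _) ((hi _).const_mul _)]
  refine integral_congr_ae (ae_restrict_of_ae ?_)
  filter_upwards [coeFn_mulOp f h, coeFn_mulOp g h] with φ e1 e2
  rw [e1, e2, kernel]
  ring

/-! ### Compactness for continuous symbols -/

theorem fourierCoeff_mulOp_fourierLp (n : ℤ) (h : L2) (k : ℤ) :
    fourierCoeff (mulOp (fourierLp ∞ n) h) k = fourierCoeff h (k - n) := by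
  unfold fourierCoeff
  refine integral_congr_ae ?_
  filter_upwards [coeFn_mulOp (fourierLp ∞ n) h, coeFn_fourierLp (T := 2 * Real.pi) ∞ n]
    with θ h1 h2
  rw [h1, h2, smul_eq_mul, smul_eq_mul, ← mul_assoc, ← fourier_add]
  congr 3
  ring

theorem fourierLp_mem_H2_orthogonal {n : ℤ} (hn : n < 0) : (fourierLp 2 n : L2) ∈ H2ᗮ := by
  rw [Submodule.mem_orthogonal']
  intro h hh
  rw [← fourierCoeff_eq_inner]
  exact hh n hn

/-- The antianalytic part of `e^{inθ} h`, for `h ∈ H²`, is a trigonometric polynomial. -/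
theorem coe_Rminus_mulOp_fourierLp (n : ℤ) {h : L2} (hh : h ∈ H2) :
    (Rminus (mulOp (fourierLp ∞ n) h) : L2) =
      ∑ k ∈ Finset.Ico 0 (-n), inner ℂ (fourierLp 2 k : L2) h • (fourierLp 2 (k + n) : L2) := by
  set v : L2 :=
    ∑ k ∈ Finset.Ico 0 (-n), inner ℂ (fourierLp 2 k : L2) h • (fourierLp 2 (k + n) : L2) with hv
  set u : L2 := mulOp (fourierLp ∞ n) h with hu
  have hvm : v ∈ H2ᗮ := Submodule.sum_mem _ fun k hk =>
    Submodule.smul_mem _ _ (fourierLp_mem_H2_orthogonal (by rw [Finset.mem_Ico] at hk; omega))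
  have hum : u - v ∈ H2 := by
    intro m hm
    rw [fourierCoeff_eq_inner, inner_sub_right, ← fourierCoeff_eq_inner,
      fourierCoeff_mulOp_fourierLp, hv, inner_sum]
    have e : ∀ k : ℤ, inner ℂ (fourierLp 2 m : L2)
        (inner ℂ (fourierLp 2 k : L2) h • (fourierLp 2 (k + n) : L2)) =
        if m - n = k then fourierCoeff h (m - n) else 0 := by
      intro k
      rw [inner_smul_right, orthonormal_iff_ite.1 (orthonormal_fourier (T := 2 * Real.pi)),
        fourierCoeff_eq_inner]
      by_cases hk : m - n = k
      · rw [if_pos (by omega), if_pos hk, hk, mul_one]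
      · rw [if_neg (by omega), if_neg hk, mul_zero]
    simp only [e, Finset.sum_ite_eq, Finset.mem_Ico]
    split_ifs with hk
    · exact sub_self _
    · rw [hh _ (by omega), sub_zero]
  have h1 : H2.starProjection u = u - v :=
    Submodule.eq_starProjection_of_mem_orthogonal' hum hvm (sub_add_cancel u v).symm
  have h2 : (Rplus u : L2) = u - v := h1
  rw [coe_Rminus, h2, sub_sub_cancel]

/-- The Hankel operator, with values in `L²`, as a continuous linear function of its symbol. -/
def hankelL : LInfty →L[ℂ] H2 →L[ℂ] L2 :=
  (flip ∘L H2ᗮ.subtypeL ∘L Rminus).postcomp H2 ∘L H2.subtypeL.precomp L2 ∘L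
    (ContinuousLinearMap.mul ℂ ℂ).holderL arc ∞ 2 2

theorem hankelL_apply (φ : LInfty) (h : H2) :
    hankelL φ h = flip (Rminus (mulOp φ h) : L2) := rfl

/-- Only the finitely many frequencies `0 ≤ k < -n` are shifted below zero, so the operator is a
finite sum of rank-one maps. -/
theorem isCompactOperator_hankelL_fourierLp (n : ℤ) :
    IsCompactOperator (hankelL (fourierLp ∞ n)) := by
  have h : hankelL (fourierLp ∞ n) = ∑ k ∈ Finset.Ico 0 (-n),
      ContinuousLinearMap.toSpanSingleton ℂ (flip (fourierLp 2 (k + n) : L2)) ∘L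
        (innerSL ℂ (fourierLp 2 k : L2) ∘L H2.subtypeL) := by
    ext1 x
    rw [hankelL_apply, coe_Rminus_mulOp_fourierLp n x.2, map_sum, sum_apply]
    refine Finset.sum_congr rfl fun k _ => ?_
    rw [map_smul]
    rfl
  rw [h]
  refine Submodule.sum_mem (compactOperator (RingHom.id ℂ) H2 L2) fun k _ => ?_
  have hk : IsCompactOperator (innerSL ℂ (fourierLp 2 k : L2) ∘L H2.subtypeL) :=
    isCompactOperator_of_locallyCompactSpace_dom _
  exact hk.clm_comp (ContinuousLinearMap.toSpanSingleton ℂ (flip (fourierLp 2 (k + n) : L2)))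

/-- Hankel operators with continuous symbol are compact. -/
theorem isCompactOperator_hankel {f : LInfty} {F : C(T, ℂ)} (hF : ∀ᵐ θ ∂arc, f θ = F θ) :
    IsCompactOperator (hankel f) := by
  have hf : f = ContinuousMap.toLp ∞ arc ℂ F :=
    Lp.ext (by
      filter_upwards [hF, ContinuousMap.coeFn_toLp (p := ∞) (𝕜 := ℂ) arc F] with θ h1 h2
      rw [h1, h2])
  set B : C(T, ℂ) →L[ℂ] H2 →L[ℂ] L2 := hankelL ∘L ContinuousMap.toLp ∞ arc ℂ
  set S : Submodule ℂ C(T, ℂ) :=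
    (compactOperator (RingHom.id ℂ) H2 L2).comap B.toLinearMap with hS
  -- Compact operators form a norm-closed set and the Hankel operator depends continuously on its
  -- symbol in sup norm; density of trigonometric polynomials then gives every continuous symbol.
  have hclosed : IsClosed (S : Set C(T, ℂ)) :=
    isClosed_setOfPred_isCompactOperator.preimage B.continuous
  have hspan : Submodule.span ℂ (Set.range (fourier (T := 2 * Real.pi))) ≤ S := by
    rw [Submodule.span_le]
    rintro _ ⟨n, rfl⟩
    exact isCompactOperator_hankelL_fourierLp n
  have hFS : F ∈ S := by
    have := Submodule.topologicalClosure_minimal _ hspan hclosed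
    rw [span_fourier_closure_eq_top] at this
    exact this trivial
  have hc : IsCompactOperator (hankelL f) := by rw [hf]; exact hFS
  exact hc.codRestrict (V := H2) (fun h => flip_mem_H2 (Rminus (mulOp f h)).2) isClosed_H2

end HankelCircle

end

theorem mainTheorem6 (f g : HankelCircle.LInfty)
    (hfg : ∀ᵐ θ ∂HankelCircle.arc, conj (f θ) = g θ) :
    ∃ W : HankelCircle.L2 →L[ℂ] HankelCircle.L2,
      HankelCircle.IsIntegralOperator (HankelCircle.kernel f g) W ∧
      IsSelfAdjoint W ∧
      HankelCircle.compression W =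
        ContinuousLinearMap.adjoint (HankelCircle.hankel f) ∘L HankelCircle.hankel f -
        ContinuousLinearMap.adjoint (HankelCircle.hankel g) ∘L HankelCircle.hankel g ∧
      ((∃ F : C(HankelCircle.T, ℂ), ∀ᵐ θ ∂HankelCircle.arc, f θ = F θ) →
        IsCompactOperator (HankelCircle.compression W)) := by
  refine ⟨HankelCircle.commutatorOp f g, HankelCircle.isIntegralOperator_commutatorOp f g,
    HankelCircle.isSelfAdjoint_commutatorOp hfg, HankelCircle.compression_commutatorOp hfg, ?_⟩
  rintro ⟨F, hF⟩
  have hG : ∀ᵐ θ ∂HankelCircle.arc, g θ = (star F) θ := by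
    filter_upwards [hfg, hF] with θ h1 h2
    rw [← h1, h2]
    rfl
  rw [HankelCircle.compression_commutatorOp hfg]
  have h1 := (HankelCircle.isCompactOperator_hankel hF).clm_comp
    (ContinuousLinearMap.adjoint (HankelCircle.hankel f))
  have h2 := (HankelCircle.isCompactOperator_hankel hG).clm_comp
    (ContinuousLinearMap.adjoint (HankelCircle.hankel g))
  exact h1.sub h2
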